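/- Words are finite words over $\{0,1\}$; $|w|_x$ is the number of occurrences of the letter $x$ in $w$, and the Parikh vector of $w$ is $(|w|_0,|w|_1)$. A word encodes the lattice path starting at $(0,0)$ in which each $0$ is a unit step to the right and each $1$ a unit step up. A word $w$ with Parikh vector $(a,b)$ is called (upward) digitally convex if it is the best approximation from below of an upward convex (that is, concave) curve $C$ that joins $(0,0)$ to $(a,b)$ inside the rectangle $[0,a]\times[0,b]$ (the curve may begin with a vertical segment on the left side of the rectangle): the path of $w$ does not go above $C$, and every point of $\mathbb{N}\times\mathbb{N}$ that lies on or below $C$ lies on or below the path of $w$. Let $a,b\ge 0$ be integers and let $\mathcal{DC}_{a,b}$ be the set of all digitally convex words with Parikh vector $(a,b)$. An inflation changes a digitally convex word $u01v$ into the word $u10v$, provided that $u10v$ is digitally convex as well. For $u,v\in\mathcal{DC}_{a,b}$ write $u\leq_I v$ if a (possibly empty) finite sequence of inflations leads from $u$ to $v$, and write $u\sqsubseteq v$ (dominance order) if, for every $1\le i\le a+b$, the prefix of length $i$ of $u$ contains at most as many $1$s as the prefix of length $i$ of $v$. **Theorem.** For all integers $a,b\ge 0$, the relations $\leq_I$ and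 $\sqsubseteq$ are partial orders on $\mathcal{DC}_{a,b}$, and they coincide: for all $u,v\in\mathcal{DC}_{a,b}$, $$u\leq_I v\iff u\sqsubseteq v .$$ -/

import Mathlib

/-- Binary words over the alphabet `{0, 1}`. -/
abbrev BinWord := List (Fin 2)

/-- The lattice points visited by the path from `(0,0)` that the word `w` encodes, where the letter
`0` is a horizontal unit step and the letter `1` a vertical unit step. -/
def latticePath (w : BinWord) : Set (ℕ × ℕ) :=
  {p | ∃ k ≤ w.length, p = ((w.take k).count 0, (w.take k).count 1)}

/-- `C` is an upward convex curve joining `(0,0)` to `(a,b)` inside the rectangle with opposite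
vertices `(0,0)` and `(a,b)`: a (possibly trivial) vertical segment from `(0,0)` to `(0, f 0)`,
followed by the graph over `[0,a]` of a continuous concave function `f` that ends at `(a,b)`.
(A concave curve that stays in the rectangle and ends at its upper right corner is nondecreasing,
so the only place where it can be vertical is the left side of the rectangle.) -/
def IsUpwardConvexCurve (a b : ℕ) (C : Set (ℝ × ℝ)) : Prop :=
  ∃ f : ℝ → ℝ,
    ContinuousOn f (Set.Icc (0 : ℝ) (a : ℝ)) ∧
    ConcaveOn ℝ (Set.Icc (0 : ℝ) (a : ℝ)) f ∧
    (∀ x ∈ Set.Icc (0 : ℝ) (a : ℝ), f x ∈ Set.Icc (0 : ℝ) (b : ℝ)) ∧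
    f (a : ℝ) = (b : ℝ) ∧
    C = {p : ℝ × ℝ | p.1 = 0 ∧ 0 ≤ p.2 ∧ p.2 ≤ f 0} ∪
        {p : ℝ × ℝ | p.1 ∈ Set.Icc (0 : ℝ) (a : ℝ) ∧ p.2 = f p.1}

/-- The point `p` lies on or (vertically) below the planar set `C`. -/
def OnOrBelow (p : ℝ × ℝ) (C : Set (ℝ × ℝ)) : Prop :=
  ∃ q ∈ C, q.1 = p.1 ∧ p.2 ≤ q.2

/-- The path of `w` is the best approximation from below of the curve `C`: it does not go above `C`,
and every lattice point (of the first quadrant) on or below `C` is on or below the path, so that no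
lattice point separates the path from the curve. (The part of the plane under an upward convex curve
is convex, so that a path whose lattice points do not go above the curve does not cross it.) -/
def IsBestApproxFromBelow (w : BinWord) (C : Set (ℝ × ℝ)) : Prop :=
  (∀ p ∈ latticePath w, OnOrBelow ((p.1 : ℝ), (p.2 : ℝ)) C) ∧
  (∀ i j : ℕ, OnOrBelow ((i : ℝ), (j : ℝ)) C → ∃ q ∈ latticePath w, q.1 = i ∧ j ≤ q.2)

/-- (Upward) digitally convex words. -/
def IsDigitallyConvex (w : BinWord) : Prop :=
  ∃ C : Set (ℝ × ℝ), IsUpwardConvexCurve (w.count 0) (w.count 1) C ∧ IsBestApproxFromBelow w C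

/-- The set `DC_{a,b}` of digitally convex words with Parikh vector `(a,b)`. -/
def DC (a b : ℕ) : Set BinWord :=
  {w | w.count 0 = a ∧ w.count 1 = b ∧ IsDigitallyConvex w}

/-- `w'` is obtained from `w` by one inflation: an occurrence of `01` in the digitally convex word
`w` is changed into `10`, and the resulting word `w'` is digitally convex. -/
def IsInflation (w w' : BinWord) : Prop :=
  IsDigitallyConvex w ∧ IsDigitallyConvex w' ∧
    ∃ u v : BinWord, w = u ++ [0, 1] ++ v ∧ w' = u ++ [1, 0] ++ v

/-- The inflation order on `DC_{a,b}`: there is a (possibly empty) finite sequence of inflations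
leading from `u` to `v`. -/
def InflationLE (a b : ℕ) (u v : DC a b) : Prop :=
  Relation.ReflTransGen (fun x y : DC a b => IsInflation x.1 y.1) u v

/-- The dominance order on binary words of equal length: every prefix of `u` has at most as many
`1`s as the prefix of `v` of the same length. -/
def Dominated (u v : BinWord) : Prop :=
  u.length = v.length ∧
    ∀ i : ℕ, 1 ≤ i → i ≤ u.length → (u.take i).count 1 ≤ (v.take i).count 1

/-- The dominance order restricted to `DC_{a,b}`. -/
def DominanceLE (a b : ℕ) (u v : DC a b) : Prop :=
  Dominated u.1 v.1

/-!
The only substantial claim is that dominance implies the existence of a chain of inflations. A word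
is described by the heights of its path over the columns `0, …, a` (`colHeight`): the word is
digitally convex exactly when some concave function has these heights as the integer parts of its
values at the columns (`isDigitallyConvex_iff`), and for words with the same Parikh vector dominance
is the pointwise order of the heights (`dominated_iff_colHeight_le`).

Let `u ≠ v` be digitally convex with `u` dominated by `v`, let `F` and `G` be concave functions for
`u` and `v`, and let `g` be the height function of `v`. Among the columns where `g - F` attains its
maximum `M > 0`, let `i` be the leftmost one; there the height of `v` exceeds that of `u`. The concave
function `F + M` lies above `g` and touches it at `i`. Lowering it by a small `δ` and tilting it
around `i` with slope `δ` produces a concave function that stays above `g` in all columns but `i`,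
where it falls below `g`. Its minimum with `G` is therefore a concave function for the
heights of `v` lowered by one in column `i` (`exists_deflated_profile`). Concavity forces the path of
`v` to have a corner `10` in column `i`, so that replacing it by `01` gives a digitally convex
word that still dominates `u` and leads to `v` by one inflation. Induction on the sum of the heights
of `v` finishes the argument.
-/

/-! ### Column heights of a word -/

/-- The height of the highest point of the path of a word in a given column. The value is
meaningful only for columns up to the number of `0`s; further to the right it is the number of
`1`s. -/
def colHeight : BinWord → ℕ → ℕ
  | [], _ => 0
  | 1 :: w, i => colHeight w i + 1
  | 0 :: _, 0 => 0
  | 0 :: w, i + 1 => colHeight w i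

@[simp] lemma colHeight_nil (i : ℕ) : colHeight [] i = 0 := by simp [colHeight]

@[simp] lemma colHeight_one_cons (w : BinWord) (i : ℕ) :
    colHeight (1 :: w) i = colHeight w i + 1 := by simp [colHeight]

@[simp] lemma colHeight_zero_cons_zero (w : BinWord) : colHeight (0 :: w) 0 = 0 := by
  simp [colHeight]

@[simp] lemma colHeight_zero_cons_succ (w : BinWord) (i : ℕ) :
    colHeight (0 :: w) (i + 1) = colHeight w i := by simp [colHeight]

lemma fin_two_cases (x : Fin 2) : x = 0 ∨ x = 1 := by omega

lemma colHeight_mono (w : BinWord) : Monotone (colHeight w) := by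
  induction w with
  | nil => intro i j _; simp
  | cons x w ih =>
    intro i j hij
    rcases fin_two_cases x with rfl | rfl
    · cases i with
      | zero => simp
      | succ i =>
        obtain ⟨j, rfl⟩ : ∃ k, j = k + 1 := ⟨j - 1, by omega⟩
        simpa using ih (by omega)
    · simpa using ih hij

lemma count_one_take_le_colHeight (w : BinWord) (k : ℕ) :
    (w.take k).count 1 ≤ colHeight w ((w.take k).count 0) := by
  induction w generalizing k with
  | nil => simp
  | cons x w ih =>
    cases k with
    | zero => simp
    | succ k => rcases fin_two_cases x with rfl | rfl <;> simpa using ih k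

lemma exists_take_eq_colHeight (w : BinWord) {i : ℕ} (hi : i ≤ w.count 0) :
    ∃ k ≤ w.length, (w.take k).count 0 = i ∧ (w.take k).count 1 = colHeight w i := by
  induction w generalizing i with
  | nil => exact ⟨0, by simp_all⟩
  | cons x w ih =>
    rcases fin_two_cases x with rfl | rfl
    · cases i with
      | zero => exact ⟨0, by simp⟩
      | succ i =>
        obtain ⟨k, hk, h0, h1⟩ := ih (i := i) (by simpa using hi)
        exact ⟨k + 1, by simpa using hk, by simpa using h0, by simpa using h1⟩
    · obtain ⟨k, hk, h0, h1⟩ := ih (i := i) (by simpa using hi)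
      exact ⟨k + 1, by simpa using hk, by simpa using h0, by simpa using h1⟩

lemma count_zero_add_count_one (w : BinWord) : w.count 0 + w.count 1 = w.length := by
  induction w with
  | nil => simp
  | cons x w ih => rcases fin_two_cases x with rfl | rfl <;> simp <;> omega

lemma count_take_mono (w : BinWord) (x : Fin 2) {k l : ℕ} (h : k ≤ l) :
    (w.take k).count x ≤ (w.take l).count x :=
  (List.take_sublist_take_left h).count_le x

/-- The path of `s10t` is one higher than that of `s01t`, in the column of the corner only. -/
lemma colHeight_swap (s t : BinWord) (j : ℕ) :
    colHeight (s ++ [1, 0] ++ t) j =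
      colHeight (s ++ [0, 1] ++ t) j + if j = s.count 0 then 1 else 0 := by
  induction s generalizing j with
  | nil => cases j <;> simp
  | cons x s ih =>
    simp only [List.append_assoc, List.cons_append, List.nil_append] at ih
    rcases fin_two_cases x with rfl | rfl
    · cases j <;> simp [ih]
    · simp [ih]; omega

/-- A column that is higher than the preceding one and not the last one ends in a corner `10`. -/
lemma exists_corner (w : BinWord) {i : ℕ} (hi : i < w.count 0) (hpos : 0 < colHeight w i)
    (hlt : ∀ j, i = j + 1 → colHeight w j < colHeight w i) :
    ∃ s t : BinWord, w = s ++ [1, 0] ++ t ∧ s.count 0 = i := by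
  induction w generalizing i with
  | nil => simp at hi
  | cons x w ih =>
    rcases fin_two_cases x with rfl | rfl
    · cases i with
      | zero => simp at hpos
      | succ i =>
        have h := hlt i rfl
        rw [colHeight_zero_cons_succ] at h
        obtain ⟨s, t, rfl, hs⟩ := ih (i := i) (by simpa using hi) (by omega) (by
          rintro j rfl
          simpa using h)
        exact ⟨0 :: s, t, by simp, by simpa using hs⟩
    · have hi' : i < w.count 0 := by simpa using hi
      by_cases h0 : 0 < colHeight w i
      · obtain ⟨s, t, rfl, hs⟩ := ih hi' h0 (fun j hj => by simpa using hlt j hj)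
        exact ⟨1 :: s, t, by simp, by simpa using hs⟩
      · cases i with
        | succ i =>
          have h := hlt i rfl
          simp only [colHeight_one_cons] at h
          omega
        | zero =>
          cases w with
          | nil => simp at hi'
          | cons y w =>
            rcases fin_two_cases y with rfl | rfl
            · exact ⟨[], w, by simp, by simp⟩
            · simp at h0

/-! ### The dominance order -/

lemma dominated_iff {u v : BinWord} :
    Dominated u v ↔
      u.length = v.length ∧ ∀ k, (u.take k).count 1 ≤ (v.take k).count 1 := by
  refine ⟨fun ⟨hl, h⟩ => ⟨hl, fun k => ?_⟩, fun ⟨hl, h⟩ => ⟨hl, fun k _ _ => h k⟩⟩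
  rcases Nat.eq_zero_or_pos k with rfl | hk
  · simp
  by_cases hku : k ≤ u.length
  · exact h k hk hku
  · rcases Nat.eq_zero_or_pos u.length with hu | hu
    · simp [List.length_eq_zero_iff.mp hu]
    · have := h u.length hu le_rfl
      rwa [List.take_length, hl, List.take_length,
        ← List.take_of_length_le (l := u) (i := k) (by omega),
        ← List.take_of_length_le (l := v) (i := k) (by omega)] at this

lemma Dominated.refl (u : BinWord) : Dominated u u := ⟨rfl, fun _ _ _ => le_rfl⟩

lemma Dominated.trans {u v w : BinWord} (h₁ : Dominated u v) (h₂ : Dominated v w) :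
    Dominated u w := by
  rw [dominated_iff] at *
  exact ⟨h₁.1.trans h₂.1, fun k => (h₁.2 k).trans (h₂.2 k)⟩

lemma eq_of_count_one_take_eq {u v : BinWord} (hl : u.length = v.length)
    (h : ∀ k, (u.take k).count 1 = (v.take k).count 1) : u = v := by
  induction u generalizing v with
  | nil => exact (List.length_eq_zero_iff.mp hl.symm).symm
  | cons x u ih =>
    cases v with
    | nil => simp at hl
    | cons y v =>
      have hxy : x = y := by
        have := h 1
        rcases fin_two_cases x with rfl | rfl <;> rcases fin_two_cases y with rfl | rfl <;>
          simp_all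
      subst hxy
      rw [ih (v := v) (by simpa using hl) fun k => by
        have := h (k + 1)
        simpa [List.count_cons] using this]

lemma Dominated.antisymm {u v : BinWord} (h₁ : Dominated u v) (h₂ : Dominated v u) : u = v := by
  rw [dominated_iff] at *
  exact eq_of_count_one_take_eq h₁.1 fun k => (h₁.2 k).antisymm (h₂.2 k)

lemma dominated_iff_colHeight_le {u v : BinWord} (h0 : u.count 0 = v.count 0)
    (h1 : u.count 1 = v.count 1) :
    Dominated u v ↔ ∀ i ≤ u.count 0, colHeight u i ≤ colHeight v i := by
  have hl : u.length = v.length := by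
    rw [← count_zero_add_count_one, ← count_zero_add_count_one, h0, h1]
  have hsum : ∀ k, (u.take k).count 0 + (u.take k).count 1 =
      (v.take k).count 0 + (v.take k).count 1 := fun k => by
    simp [count_zero_add_count_one, hl]
  rw [dominated_iff]
  constructor
  · rintro ⟨-, h⟩ i hi
    obtain ⟨k, -, hk0, hk1⟩ := exists_take_eq_colHeight u hi
    have := hsum k
    have hk := h k
    calc colHeight u i = (u.take k).count 1 := hk1.symm
      _ ≤ (v.take k).count 1 := hk
      _ ≤ colHeight v ((v.take k).count 0) := count_one_take_le_colHeight v k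
      _ ≤ colHeight v i := colHeight_mono v (by omega)
  · refine fun h => ⟨hl, fun k => ?_⟩
    by_contra! hlt
    -- After `k` steps the path of `v` has already left the column that the path of `u` is in then,
    -- yet it reaches the top of that column only after `l ≥ k` steps.
    have hi : (u.take k).count 0 ≤ u.count 0 := (List.take_sublist k u).count_le 0
    obtain ⟨l, -, hl0, hl1⟩ := exists_take_eq_colHeight v (h0 ▸ hi)
    have hle := (count_one_take_le_colHeight u k).trans (h _ hi)
    have := hsum k
    rcases le_total k l with hkl | hkl
    · have := count_take_mono v 0 hkl
      omega
    · have := count_take_mono v 1 hkl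
      omega

/-! ### Digital convexity in terms of column heights -/

/-- `f` is a concave function on `[0,a]` whose graph is an upward convex curve in the rectangle with
corners `(0,0)` and `(a,b)`, and whose integer parts at the columns `0, …, a` are given by `g`. -/
structure IsProfile (a b : ℕ) (g : ℕ → ℕ) (f : ℝ → ℝ) : Prop where
  continuousOn : ContinuousOn f (Set.Icc (0 : ℝ) (a : ℝ))
  concaveOn : ConcaveOn ℝ (Set.Icc (0 : ℝ) (a : ℝ)) f
  mem_Icc : ∀ x ∈ Set.Icc (0 : ℝ) (a : ℝ), f x ∈ Set.Icc (0 : ℝ) (b : ℝ)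
  map_right : f (a : ℝ) = (b : ℝ)
  le_map : ∀ i ≤ a, (g i : ℝ) ≤ f i
  map_lt : ∀ i ≤ a, f i < g i + 1

lemma natCast_mem_Icc {a i : ℕ} (hi : i ≤ a) : (i : ℝ) ∈ Set.Icc (0 : ℝ) (a : ℝ) :=
  ⟨by positivity, by exact_mod_cast hi⟩

lemma onOrBelow_iff {a : ℕ} {f : ℝ → ℝ} {x y : ℝ} :
    OnOrBelow (x, y) ({p : ℝ × ℝ | p.1 = 0 ∧ 0 ≤ p.2 ∧ p.2 ≤ f 0} ∪
        {p : ℝ × ℝ | p.1 ∈ Set.Icc (0 : ℝ) (a : ℝ) ∧ p.2 = f p.1}) ↔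
      x ∈ Set.Icc (0 : ℝ) (a : ℝ) ∧ y ≤ f x := by
  constructor
  · rintro ⟨⟨p, q⟩, ⟨hp, -, hq⟩ | ⟨hp, hq⟩, rfl, hy⟩
    · dsimp only at *
      subst hp
      exact ⟨⟨le_rfl, by positivity⟩, hy.trans hq⟩
    · exact ⟨hp, hy.trans hq.le⟩
  · rintro ⟨hx, hy⟩
    exact ⟨(x, f x), Or.inr ⟨hx, rfl⟩, rfl, hy⟩

lemma isDigitallyConvex_iff {w : BinWord} :
    IsDigitallyConvex w ↔ ∃ f, IsProfile (w.count 0) (w.count 1) (colHeight w) f := by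
  constructor
  · rintro ⟨C, ⟨f, hc, hv, hm, hr, rfl⟩, hlow, hbest⟩
    refine ⟨f, hc, hv, hm, hr, fun i hi => ?_, fun i hi => ?_⟩
    · obtain ⟨k, hk, h0, h1⟩ := exists_take_eq_colHeight w hi
      have := hlow _ ⟨k, hk, rfl⟩
      rw [onOrBelow_iff] at this
      simpa [h0, h1] using this.2
    · by_contra! hge
      obtain ⟨q, ⟨k, hk, rfl⟩, hq0, hq1⟩ := hbest i (colHeight w i + 1)
        (onOrBelow_iff.mpr ⟨natCast_mem_Icc hi, by exact_mod_cast hge⟩)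
      have := count_one_take_le_colHeight w k
      dsimp only at hq0 hq1
      rw [hq0] at this
      omega
  · rintro ⟨f, hf⟩
    refine ⟨_, ⟨f, hf.continuousOn, hf.concaveOn, hf.mem_Icc, hf.map_right, rfl⟩, ?_, ?_⟩
    · rintro _ ⟨k, -, rfl⟩
      have hk : (w.take k).count 0 ≤ w.count 0 := (List.take_sublist k w).count_le 0
      refine onOrBelow_iff.mpr ⟨natCast_mem_Icc hk, le_trans ?_ (hf.le_map _ hk)⟩
      exact_mod_cast count_one_take_le_colHeight w k
    · intro i j hij
      obtain ⟨hi, hj⟩ := onOrBelow_iff.mp hij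
      have hi' : i ≤ w.count 0 := by exact_mod_cast hi.2
      obtain ⟨k, hk, h0, h1⟩ := exists_take_eq_colHeight w hi'
      refine ⟨_, ⟨k, hk, rfl⟩, h0, ?_⟩
      have : (j : ℝ) < (colHeight w i + 1 : ℕ) := by
        push_cast
        exact hj.trans_lt (hf.map_lt i hi')
      have : j < colHeight w i + 1 := by exact_mod_cast this
      dsimp only
      omega

/-! ### Deflating a concave profile -/

lemma concaveOn_affine (s : Set ℝ) (hs : Convex ℝ s) (c m : ℝ) :
    ConcaveOn ℝ s fun x => c + m * x := by
  refine ⟨hs, fun x _ y _ p q _ _ hpq => le_of_eq ?_⟩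
  simp only [smul_eq_mul]
  linear_combination c * hpq

/-- If some height of `g` exceeds that of `k`, then `g` can be lowered by one in a column where it
exceeds `k`, in such a way that it remains the family of integer parts of a concave function. -/
lemma exists_deflated_profile {a b : ℕ} {k g : ℕ → ℕ} {F G : ℝ → ℝ} (hF : IsProfile a b k F)
    (hG : IsProfile a b g G) (hlt : ∃ i ≤ a, k i < g i) :
    ∃ i < a, k i < g i ∧
      ∃ f, IsProfile a b (fun j => if j = i then g j - 1 else g j) f := by
  obtain ⟨i₀, hi₀, hlt⟩ := hlt
  set d : ℕ → ℝ := fun j => g j - F j with hd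
  have hex : ∃ i, i ≤ a ∧ ∀ j ≤ a, d j ≤ d i := by
    obtain ⟨i, hi, h⟩ := Finset.exists_max_image (Finset.range (a + 1)) d ⟨0, by simp⟩
    exact ⟨i, by simpa [Nat.lt_succ_iff] using hi,
      fun j hj => h j (by simpa [Nat.lt_succ_iff] using hj)⟩
  classical
  obtain ⟨i, ⟨hia, hmax⟩, hmin⟩ : ∃ i, (i ≤ a ∧ ∀ j ≤ a, d j ≤ d i) ∧
      ∀ j < i, ¬ (j ≤ a ∧ ∀ l ≤ a, d l ≤ d j) :=
    ⟨Nat.find hex, Nat.find_spec hex, fun j hj => Nat.find_min hex hj⟩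
  have hleft : ∀ j < i, 0 < d i - d j := by
    intro j hj
    have := hmin j hj
    push Not at this
    obtain ⟨l, hl, hjl⟩ := this (by omega)
    linarith [hmax l hl]
  have hpos : 0 < d i := by
    have h1 := hF.map_lt i₀ hi₀
    have h2 : (k i₀ : ℝ) + 1 ≤ g i₀ := by exact_mod_cast hlt
    have h3 := hmax i₀ hi₀
    simp only [hd] at h3 ⊢
    linarith
  have hki : k i < g i := by
    have h1 := hF.le_map i hia
    have h2 : (k i : ℝ) < g i := by simp only [hd] at hpos; linarith
    exact_mod_cast h2
  have hga : g a ≤ b := by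
    have := hG.le_map a le_rfl
    rw [hG.map_right] at this
    exact_mod_cast this
  have hga' : b ≤ g a := by
    have := hG.map_lt a le_rfl
    rw [hG.map_right] at this
    exact Nat.lt_succ_iff.mp (by exact_mod_cast this)
  have hia' : i < a := by
    refine lt_of_le_of_ne hia ?_
    rintro rfl
    simp only [hd, hF.map_right] at hpos
    have : (g i : ℝ) ≤ b := by exact_mod_cast hga
    linarith
  obtain ⟨δ, hδ, hδ0⟩ : ∃ δ : ℝ, (δ ≤ 1 ∧ ∀ j ∈ Finset.range i, δ * (1 + i - j) ≤ d i - d j) ∧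
      0 < δ := by
    have h1 : ∀ᶠ δ : ℝ in nhdsWithin 0 (Set.Ioi 0), δ ≤ 1 :=
      nhdsWithin_le_nhds (Iic_mem_nhds one_pos)
    have h2 : ∀ᶠ δ : ℝ in nhdsWithin 0 (Set.Ioi 0),
        ∀ j ∈ Finset.range i, δ * (1 + i - j) ≤ d i - d j := by
      rw [Filter.eventually_all_finset]
      intro j hj
      have hc : Continuous fun δ : ℝ => δ * (1 + i - j) := by fun_prop
      have := (hc.tendsto 0).eventually_lt_const
        (by simpa using hleft j (Finset.mem_range.mp hj) : (0 : ℝ) * (1 + i - j) < d i - d j)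
      exact nhdsWithin_le_nhds (this.mono fun δ h => h.le)
    exact ((h1.and h2).and self_mem_nhdsWithin).exists
  obtain ⟨hδ1, hδ⟩ := hδ
  -- `F` is raised until it touches `g` from above, then lowered by `δ` and tilted around column `i`.
  set h : ℝ → ℝ := fun x => F x + ((d i - δ - δ * i) + δ * x) with hh
  have hhi : h i = g i - δ := by simp only [hh, hd]; ring
  have hhj : ∀ j ≤ a, j ≠ i → (g j : ℝ) ≤ h j := by
    intro j hj hji
    have e : h j - g j = d i - d j - δ + δ * (j - i) := by simp only [hh, hd]; ring
    rcases lt_or_gt_of_ne hji with hlt | hgt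
    · have := hδ j (Finset.mem_range.mpr hlt)
      linarith
    · have h1 := hmax j hj
      have h2 : (i : ℝ) + 1 ≤ j := by exact_mod_cast hgt
      nlinarith
  have hcont : ContinuousOn (fun x => min (G x) (h x)) (Set.Icc (0 : ℝ) a) :=
    hG.continuousOn.inf (hF.continuousOn.add (by fun_prop))
  have hconc : ConcaveOn ℝ (Set.Icc (0 : ℝ) a) (fun x => min (G x) (h x)) :=
    hG.concaveOn.inf (hF.concaveOn.add (concaveOn_affine _ (convex_Icc _ _) _ _))
  have hle : ∀ j ≤ a, (((if j = i then g j - 1 else g j : ℕ)) : ℝ) ≤ min (G j) (h j) := by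
    intro j hj
    have h1 := hG.le_map j hj
    split_ifs with hji
    · subst hji
      have h2 : ((g j - 1 : ℕ) : ℝ) = g j - 1 := by
        rw [Nat.cast_sub (by omega), Nat.cast_one]
      rw [h2, le_min_iff, hhi]
      constructor <;> linarith
    · exact le_min h1 (hhj j hj hji)
  have hright : min (G a) (h a) = b := by
    rw [hG.map_right]
    refine min_eq_left ?_
    have : (b : ℝ) ≤ g a := by exact_mod_cast hga'
    exact this.trans (hhj a le_rfl hia'.ne')
  refine ⟨i, hia', hki, fun x => min (G x) (h x), hcont, hconc, ?_, hright, hle, ?_⟩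
  · intro x hx
    refine ⟨?_, (min_le_left _ _).trans (hG.mem_Icc x hx).2⟩
    -- A concave function is nonnegative on an interval once it is so at both ends.
    have h0 : (0 : ℝ) ≤ min (G (0 : ℝ)) (h (0 : ℝ)) := by
      have := hle 0 (Nat.zero_le a)
      rw [Nat.cast_zero] at this
      exact le_trans (Nat.cast_nonneg _) this
    have ha : (0 : ℝ) ≤ min (G a) (h a) := by rw [hright]; positivity
    have hmin := hconc.min_le_of_mem_Icc (x := (0 : ℝ)) (y := (a : ℝ)) (z := x)
      ⟨le_rfl, by positivity⟩ ⟨by positivity, le_rfl⟩ hx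
    exact (le_min h0 ha).trans hmin
  · intro j hj
    split_ifs with hji
    · subst hji
      have h2 : ((g j - 1 : ℕ) : ℝ) = g j - 1 := by
        rw [Nat.cast_sub (by omega), Nat.cast_one]
      rw [h2]
      exact (min_le_right _ _).trans_lt (by rw [hhi]; linarith)
    · exact (min_le_left _ _).trans_lt (hG.map_lt j hj)

/-- Deflating a concave profile in a column forces that column to be strictly higher than the
preceding one. -/
lemma lt_of_deflated_profile {a b i : ℕ} {g : ℕ → ℕ} (hg : Monotone g) (hi : i + 1 < a)
    (hpos : 0 < g (i + 1)) {f : ℝ → ℝ}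
    (hf : IsProfile a b (fun j => if j = i + 1 then g j - 1 else g j) f) : g i < g (i + 1) := by
  by_contra! hle
  have h1 := hf.le_map i (by omega)
  have h2 := hf.le_map (i + 2) (by omega)
  have h3 := hf.map_lt (i + 1) (by omega)
  simp only [Nat.left_eq_add, one_ne_zero, if_false, if_true,
    show i + 2 ≠ i + 1 by omega] at h1 h2 h3
  have e : ((g (i + 1) - 1 : ℕ) : ℝ) = g (i + 1) - 1 := by
    rw [Nat.cast_sub (by omega), Nat.cast_one]
  rw [e] at h3
  have h4 : (g (i + 1) : ℝ) ≤ g i := by exact_mod_cast hle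
  have h5 : (g (i + 1) : ℝ) ≤ g (i + 2) := by exact_mod_cast hg (by omega)
  have hmid := hf.concaveOn.min_le_of_mem_Icc (z := ((i + 1 : ℕ) : ℝ))
    (natCast_mem_Icc (show i ≤ a by omega)) (natCast_mem_Icc (show i + 2 ≤ a by omega))
    ⟨by push_cast; linarith, by push_cast; linarith⟩
  rcases min_le_iff.mp hmid with h | h <;> linarith

/-! ### Inflation and dominance coincide -/

lemma IsInflation.dominated {u v : BinWord} (h : IsInflation u v) : Dominated u v := by
  obtain ⟨-, -, s, t, rfl, rfl⟩ := h
  rw [dominated_iff_colHeight_le (by simp) (by simp)]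
  intro i _
  rw [colHeight_swap]
  exact Nat.le_add_right _ _

/-- A digitally convex word that strictly dominates `u` can be deflated so that it still
dominates `u`. -/
lemma exists_isInflation {a b : ℕ} {u v : DC a b} (huv : Dominated u.1 v.1) (hne : u ≠ v) :
    ∃ w : DC a b, Dominated u.1 w.1 ∧ IsInflation w.1 v.1 := by
  obtain ⟨u, hu0, hu1, hu⟩ := u
  obtain ⟨v, hv0, hv1, hv⟩ := v
  dsimp only at huv ⊢
  have hle := (dominated_iff_colHeight_le (hu0.trans hv0.symm) (hu1.trans hv1.symm)).mp huv
  have hlt : ∃ i ≤ a, colHeight u i < colHeight v i := by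
    by_contra! hge
    refine hne (Subtype.ext (huv.antisymm ?_))
    exact (dominated_iff_colHeight_le (hv0.trans hu0.symm) (hv1.trans hu1.symm)).mpr (hv0 ▸ hge)
  obtain ⟨F, hF⟩ := isDigitallyConvex_iff.mp hu
  obtain ⟨G, hG⟩ := isDigitallyConvex_iff.mp hv
  rw [hu0, hu1] at hF
  rw [hv0, hv1] at hG
  obtain ⟨i, hia, hki, f, hf⟩ := exists_deflated_profile hF hG hlt
  obtain ⟨s, t, rfl, hs⟩ := exists_corner v (i := i) (by omega) (by omega) (by
    rintro j rfl
    exact lt_of_deflated_profile (colHeight_mono v) hia (by omega) hf)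
  have hg : (fun j => if j = i then colHeight (s ++ [1, 0] ++ t) j - 1
      else colHeight (s ++ [1, 0] ++ t) j) = colHeight (s ++ [0, 1] ++ t) := by
    funext j
    rw [colHeight_swap, hs]
    split_ifs <;> simp
  rw [hg] at hf
  have hw0 : (s ++ [0, 1] ++ t).count 0 = a := by rw [← hv0]; simp
  have hw1 : (s ++ [0, 1] ++ t).count 1 = b := by rw [← hv1]; simp
  have hw : IsDigitallyConvex (s ++ [0, 1] ++ t) :=
    isDigitallyConvex_iff.mpr ⟨f, by rwa [hw0, hw1]⟩
  refine ⟨⟨_, hw0, hw1, hw⟩, ?_, hw, hv, s, t, rfl, rfl⟩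
  rw [dominated_iff_colHeight_le (hu0.trans hw0.symm) (hu1.trans hw1.symm)]
  intro j hj
  have h := hle j hj
  rw [colHeight_swap, hs] at h hki
  split_ifs at h with hji
  · subst hji
    simp only [if_true] at hki
    omega
  · exact h

lemma inflationLE_of_dominated {a b : ℕ} {u v : DC a b} (h : Dominated u.1 v.1) :
    InflationLE a b u v := by
  induction hn : ∑ i ∈ Finset.range (a + 1), colHeight v.1 i using Nat.strong_induction_on
    generalizing v with
  | _ n ih =>
    by_cases hne : u = v
    · exact hne ▸ Relation.ReflTransGen.refl
    obtain ⟨w, huw, hwv⟩ := exists_isInflation h hne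
    refine (ih _ ?_ huw rfl).tail hwv
    obtain ⟨-, -, s, t, hws, hvs⟩ := hwv
    rw [← hn, hvs, hws]
    refine Finset.sum_lt_sum (fun j _ => ?_) ⟨s.count 0, ?_, ?_⟩
    · rw [colHeight_swap]
      exact Nat.le_add_right _ _
    · have := w.2.1
      rw [hws] at this
      simp at this
      simp; omega
    · rw [colHeight_swap, if_pos rfl]
      exact Nat.lt_succ_self _

lemma inflationLE_iff_dominanceLE {a b : ℕ} (u v : DC a b) :
    InflationLE a b u v ↔ DominanceLE a b u v := by
  refine ⟨fun h => ?_, inflationLE_of_dominated⟩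
  induction h with
  | refl => exact Dominated.refl _
  | tail _ h ih => exact Dominated.trans ih h.dominated

theorem mainTheorem2 (a b : ℕ) :
    IsPartialOrder (DC a b) (InflationLE a b) ∧
    IsPartialOrder (DC a b) (DominanceLE a b) ∧
    ∀ u v : DC a b, InflationLE a b u v ↔ DominanceLE a b u v := by
  have hdom : IsPartialOrder (DC a b) (DominanceLE a b) :=
    { refl := fun u => Dominated.refl u.1
      trans := fun _ _ _ h₁ h₂ => Dominated.trans h₁ h₂
      antisymm := fun _ _ h₁ h₂ => Subtype.ext (Dominated.antisymm h₁ h₂) }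
  have heq : InflationLE a b = DominanceLE a b := by
    funext u v
    exact propext (inflationLE_iff_dominanceLE u v)
  exact ⟨heq ▸ hdom, hdom, inflationLE_iff_dominanceLE⟩
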